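/- All graphs are finite, simple and undirected. A pseudoforest is a graph in which every connected component contains at most one cycle. Every graph with $n$ vertices and $m$ edges has an induced subgraph that is a pseudoforest and has at least $n-\frac{2m}{9}$ vertices. Moreover, this bound is tight: for every integer $k\ge 0$, the disjoint union of $k$ copies of the complete bipartite graph $K_{3,3}$ has $n=6k$ vertices and $m=9k$ edges, and its largest induced pseudoforest has exactly $n-\frac{2m}{9}$ vertices. -/

import Mathlib

/-- A pseudoforest: every connected component has at most one cycle. A cycle is a subgraph; it is
given by a closed walk that traverses it, and two closed walks give the same cycle when they use
the same edges. -/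
def SimpleGraph.IsPseudoforest {V : Type*} (G : SimpleGraph V) : Prop :=
  ∀ ⦃u v : V⦄ (p : G.Walk u u) (q : G.Walk v v),
    p.IsCycle → q.IsCycle → G.Reachable u v → ∀ e : Sym2 V, e ∈ p.edges ↔ e ∈ q.edges

/-- The disjoint union of `k` copies of the graph `G`. -/
def SimpleGraph.disjointCopies {V : Type*} (k : ℕ) (G : SimpleGraph V) :
    SimpleGraph (Fin k × V) where
  Adj x y := x.1 = y.1 ∧ G.Adj x.2 y.2
  symm := ⟨fun _ _ h => ⟨h.1.symm, h.2.symm⟩⟩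
  loopless := ⟨fun _ h => h.2.ne rfl⟩

/-! If the edges of a graph can be oriented with at most one leaving each vertex, the graph is a
pseudoforest (`OrientedBy.isPseudoforest`). So it suffices to find a set `R` with `9|R| ≤ 2m` whose
removal leaves such a graph, the orientation being recorded by a map `f`. `HasSlack` measures the
surplus `2m - 9|R|`, and `hasSlack_zero` shows by induction on the number of edges that it can be
made nonnegative. Deleting a vertex means isolating it, so the vertex type never changes.

Putting a vertex of degree `d` into `R` changes the slack by `2d - 9`. Keeping a pendant vertex, or
suppressing a vertex of degree 2 with nonadjacent neighbors, gains 2; keeping an isolated triangle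
gains 6. Hence a vertex of degree 1, 2 or at least 5 yields slack 1 (`hasSlack_one_of_deg`), and
only degrees 0, 3 and 4 remain. A vertex of degree 4 costs 1. If it has a neighbor of degree 3, its
deletion leaves a vertex of degree 2, which pays the cost. If degree-4 vertices are adjacent only to
each other, deleting one leaves neighbors of degree 3, and the surplus comes from
`hasSlack_one_of_adj_of_deg`, whose exceptional case is excluded by comparing two deletions, or else
the component is `K₅`. If all degrees are 0 or 3, a deletion costs 3, repaid by a suppression and a
remaining vertex of degree 2, or by the triangle left from `K₄`.

For tightness, any five vertices of `K₃,₃` contain `K₂,₃`, which has two distinct cycles in one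
component. -/

namespace SimpleGraph

/-! ### Orientations of out-degree at most one, and pseudoforests -/

section Orientation

variable {V W : Type*}

/-- Every edge of `G` joins some vertex to its image under `f`. -/
def OrientedBy (G : SimpleGraph V) (f : V → V) : Prop :=
  ∀ ⦃x y : V⦄, G.Adj x y → f x = y ∨ f y = x

theorem Reachable.mono_of_adj {G H : SimpleGraph V} (h : ∀ x y, G.Adj x y → H.Reachable x y)
    {u v : V} (huv : G.Reachable u v) : H.Reachable u v := by
  obtain ⟨p⟩ := huv
  induction p with
  | nil => rfl
  | cons hadj _ ih => exact (h _ _ hadj).trans ih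

/-- A graph oriented by `g` has no cycle in the connected component of a fixed point of `g`. -/
theorem OrientedBy.not_isCycle {G : SimpleGraph V} {g : V → V} (hg : G.OrientedBy g) {r : V}
    (hr : g r = r) {v : V} (q : G.Walk v v) (hq : q.IsCycle) : ¬ G.Reachable r v := by
  classical
  intro hrv
  have hex : ∀ y, G.Reachable r y → ∃ k, g^[k] y = r := by
    rintro y ⟨p⟩
    suffices H : ∀ a b (_ : G.Walk a b), (∃ k, g^[k] a = r) → ∃ k, g^[k] b = r from
      H _ _ p ⟨0, rfl⟩
    intro a b p
    induction p with
    | nil => exact id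
    | @cons a c b hadj _ ih =>
      rintro ⟨k, hk⟩
      apply ih
      rcases hg hadj with h | h
      · refine ⟨k, ?_⟩
        rw [← h, ← Function.iterate_succ_apply, Function.iterate_succ_apply', hk, hr]
      · exact ⟨k + 1, by rw [Function.iterate_succ_apply, h, hk]⟩
  have hsup : ∀ y ∈ q.support, ∃ k, g^[k] y = r := fun y hy =>
    hex y (hrv.trans ⟨q.takeUntil y hy⟩)
  -- The number of steps from `y` to the root `r`; the default 0 is never used on the cycle, by
  -- `hsup`.
  let rank : V → ℕ := fun y => if h : ∃ k, g^[k] y = r then Nat.find h else 0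
  have hrank : ∀ y z, y ∈ q.support → z ∈ q.support → G.Adj y z → rank z ≤ rank y →
      g y = z := by
    intro y z hy hz hyz hle
    rcases hg hyz with h | h
    · exact h
    · exfalso
      have h1 := hsup y hy
      have h2 := hsup z hz
      simp only [rank, dif_pos h1, dif_pos h2] at hle
      have h3 := Nat.find_spec h2
      rcases hn : Nat.find h2 with _ | n
      · rw [hn] at h3
        have hzr : z = r := h3
        exact hyz.ne (by rw [← h, hzr, hr])
      · rw [hn, Function.iterate_succ_apply, h] at h3
        have := Nat.find_min' h1 h3
        omega
  -- Both cycle neighbors of a vertex of maximal rank must be its unique out-neighbor, yet they are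
  -- distinct.
  obtain ⟨y, hy, hmax⟩ := q.support.toFinset.exists_max_image rank
    ⟨v, by simp⟩
  rw [List.mem_toFinset] at hy
  have hc := hq.rotate hy
  have hmem : ∀ z ∈ (q.rotate y hy).support, z ∈ q.support := fun z hz => by
    simpa using hz
  have h1 : g y = (q.rotate y hy).snd := hrank _ _ hy (hmem _ (Walk.getVert_mem_support _ _))
    (Walk.adj_snd hc.not_nil)
    (hmax _ (List.mem_toFinset.2 (hmem _ (Walk.getVert_mem_support _ _))))
  have h2 : g y = (q.rotate y hy).penultimate :=
    hrank _ _ hy (hmem _ (Walk.getVert_mem_support _ _))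
      (Walk.adj_penultimate hc.not_nil).symm
    (hmax _ (List.mem_toFinset.2 (hmem _ (Walk.getVert_mem_support _ _))))
  exact hc.snd_ne_penultimate (h1.symm.trans h2)

/-- If an edge `a → b` of `p` were not in `q`, deleting it would keep the component connected, since
it lies on a cycle, and would turn `a` into a root. The cycle `q` would survive in the component of
a root. -/
theorem OrientedBy.edges_subset {G : SimpleGraph V} {f : V → V} (hf : G.OrientedBy f) {u v : V}
    (p : G.Walk u u) (q : G.Walk v v) (hp : p.IsCycle) (hq : q.IsCycle) (huv : G.Reachable u v)
    {e : Sym2 V} (he : e ∈ p.edges) : e ∈ q.edges := by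
  classical
  induction e with
  | h a b =>
  have hadj : G.Adj a b := p.adj_of_mem_edges he
  wlog hab : f a = b generalizing a b
  · rw [Sym2.eq_swap] at he ⊢
    exact this b a he hadj.symm ((hf hadj).resolve_left hab)
  by_contra hne
  have hbr : (G.deleteEdges {s(a, b)}).Reachable a b :=
    (adj_and_reachable_delete_edges_iff_exists_cycle.2 ⟨u, p, hp, he⟩).2
  have hreach : ∀ x y, G.Adj x y → (G.deleteEdges {s(a, b)}).Reachable x y := by
    intro x y hxy
    by_cases hxe : s(x, y) = s(a, b)
    · rcases Sym2.eq_iff.1 hxe with ⟨rfl, rfl⟩ | ⟨rfl, rfl⟩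
      · exact hbr
      · exact hbr.symm
    · exact Adj.reachable (by simp only [deleteEdges_adj, Set.mem_singleton_iff]; exact ⟨hxy, hxe⟩)
  have hg : (G.deleteEdges {s(a, b)}).OrientedBy (Function.update f a a) := by
    intro x y hxy
    simp only [deleteEdges_adj, Set.mem_singleton_iff] at hxy
    rcases hf hxy.1 with h | h
    · left
      rw [Function.update_of_ne, h]
      rintro rfl
      exact hxy.2 (by rw [← h, hab])
    · right
      rw [Function.update_of_ne, h]
      rintro rfl
      exact hxy.2 (by rw [← h, hab, Sym2.eq_swap])
  have hq' : ∀ e ∈ q.edges, e ∈ (G.deleteEdges {s(a, b)}).edgeSet := by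
    intro e he'
    simp only [edgeSet_deleteEdges, Set.mem_sdiff, Set.mem_singleton_iff]
    exact ⟨q.edges_subset_edgeSet he', fun h => hne (h ▸ he')⟩
  refine hg.not_isCycle (r := a) (by simp) (q.transfer _ hq') (hq.transfer hq') ?_
  have hua : G.Reachable a v := Reachable.trans (Reachable.symm
    ⟨p.takeUntil a (p.fst_mem_support_of_mem_edges he)⟩) huv
  exact hua.mono_of_adj hreach

theorem OrientedBy.isPseudoforest {G : SimpleGraph V} {f : V → V} (hf : G.OrientedBy f) :
    G.IsPseudoforest := fun _ _ p q hp hq huv _ =>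
  ⟨hf.edges_subset p q hp hq huv, hf.edges_subset q p hq hp huv.symm⟩

theorem isPseudoforest_induce {G : SimpleGraph V} {f : V → V} {s : Set V}
    (hf : ∀ x ∈ s, ∀ y ∈ s, G.Adj x y → f x = y ∨ f y = x) : (G.induce s).IsPseudoforest := by
  classical
  -- Where `f` leaves `s` the value is irrelevant; `x` itself serves as a default.
  refine OrientedBy.isPseudoforest (f := fun x => if h : f x ∈ s then ⟨f x, h⟩ else x) ?_
  rintro ⟨x, hx⟩ ⟨y, hy⟩ hxy
  rcases hf x hx y hy hxy with rfl | rfl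
  · left; simp [hy]
  · right; simp [hx]

/-- A pseudoforest contains no `K₂,₃`. -/
theorem IsPseudoforest.not_completeBipartite_two_three {G : SimpleGraph V} (hG : G.IsPseudoforest)
    {a b x y z : V} (hab : a ≠ b) (hxy : x ≠ y) (hxz : x ≠ z) (hyz : y ≠ z)
    (hax : G.Adj a x) (hay : G.Adj a y) (haz : G.Adj a z)
    (hbx : G.Adj b x) (hby : G.Adj b y) (hbz : G.Adj b z) : False := by
  -- Two 4-cycles through `a`, `x`, `b`; only the first uses the edge `by`.
  let p : G.Walk a a := .cons hax (.cons hbx.symm (.cons hby (.cons hay.symm .nil)))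
  let q : G.Walk a a := .cons hax (.cons hbx.symm (.cons hbz (.cons haz.symm .nil)))
  have hp : p.IsCycle := by
    simp only [p, Walk.isCycle_def, Walk.isTrail_def]
    simp
    grind [Adj.ne]
  have hq : q.IsCycle := by
    simp only [q, Walk.isCycle_def, Walk.isTrail_def]
    simp
    grind [Adj.ne]
  have := (hG p q hp hq (Reachable.refl a) s(b, y)).1 (by simp [p])
  simp only [q] at this
  simp at this
  grind [Adj.ne]

end Orientation

/-! ### Slack and the elementary reductions -/

section Moves

variable {V : Type*}

/-- The number of edges of `G`. -/
noncomputable def size (G : SimpleGraph V) : ℕ := G.edgeSet.ncard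

/-- The number of neighbors of `v`. -/
noncomputable def deg (G : SimpleGraph V) (v : V) : ℕ := (G.neighborSet v).ncard

theorem deg_deleteIncidenceSet_of_not_adj {G : SimpleGraph V} {u v : V} (huv : u ≠ v)
    (h : ¬ G.Adj u v) : (G.deleteIncidenceSet u).deg v = G.deg v := by
  rw [deg, deg]
  congr 1
  ext x
  simp only [mem_neighborSet, deleteIncidenceSet_adj]
  grind [Adj.symm]

theorem deg_eq_one {G : SimpleGraph V} {v : V} (h : G.deg v = 1) :
    ∃ a, ∀ y, G.Adj v y ↔ y = a := by
  obtain ⟨a, ha⟩ := Set.ncard_eq_one.1 h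
  exact ⟨a, fun y => by rw [← mem_neighborSet, ha]; simp⟩

theorem deg_eq_two {G : SimpleGraph V} {v : V} (h : G.deg v = 2) :
    ∃ a b, a ≠ b ∧ ∀ y, G.Adj v y ↔ y = a ∨ y = b := by
  obtain ⟨a, b, hab, ha⟩ := Set.ncard_eq_two.1 h
  exact ⟨a, b, hab, fun y => by rw [← mem_neighborSet, ha]; simp⟩

theorem deg_eq_two_of_adj {G : SimpleGraph V} {v a : V} (h : G.deg v = 2) (ha : G.Adj v a) :
    ∃ b, a ≠ b ∧ ∀ y, G.Adj v y ↔ y = a ∨ y = b := by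
  obtain ⟨b, c, hbc, hv⟩ := deg_eq_two h
  rcases (hv a).1 ha with rfl | rfl
  · exact ⟨c, hbc, hv⟩
  · exact ⟨b, hbc.symm, fun y => by rw [hv, or_comm]⟩

/-- Some set `R` of vertices with `9 |R| + s ≤ 2 |E(G)|` meets all edges of `G` except for edges of
a graph in which every vertex can be given at most one of its edges. -/
def HasSlack (G : SimpleGraph V) (s : ℤ) : Prop :=
  ∃ (R : Finset V) (f : V → V), (∀ x y, G.Adj x y → x ∈ R ∨ y ∈ R ∨ f x = y ∨ f y = x) ∧
    9 * (R.card : ℤ) + s ≤ 2 * G.size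

theorem HasSlack.mono {G : SimpleGraph V} {s t : ℤ} (h : G.HasSlack s) (hts : t ≤ s) :
    G.HasSlack t := by
  obtain ⟨R, f, h1, h2⟩ := h
  exact ⟨R, f, h1, by omega⟩

/-- The graph obtained by deleting `w` and joining `a` to `b`. -/
def suppress (G : SimpleGraph V) (w a b : V) : SimpleGraph V :=
  G.deleteIncidenceSet w ⊔ edge a b

theorem suppress_adj {G : SimpleGraph V} {w a b x y : V} (hab : a ≠ b) :
    (G.suppress w a b).Adj x y ↔
      (G.Adj x y ∧ x ≠ w ∧ y ≠ w) ∨ (x = a ∧ y = b) ∨ (x = b ∧ y = a) := by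
  rw [suppress, sup_adj, deleteIncidenceSet_adj, edge_adj]
  grind

variable [Finite V]

theorem size_deleteIncidenceSet_add (G : SimpleGraph V) (v : V) :
    (G.deleteIncidenceSet v).size + G.deg v = G.size := by
  classical
  have : (G.incidenceSet v).ncard = G.deg v := by
    rw [deg, ← Nat.card_coe_set_eq, ← Nat.card_coe_set_eq]
    exact Nat.card_congr (G.incidenceSetEquivNeighborSet v)
  rw [size, size, edgeSet_deleteIncidenceSet, ← this]
  exact Set.ncard_sdiff_add_ncard_of_subset (G.incidenceSet_subset v)

theorem size_deleteIncidenceSet_le (G : SimpleGraph V) (v : V) :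
    (G.deleteIncidenceSet v).size ≤ G.size := by
  have := G.size_deleteIncidenceSet_add v
  omega

theorem deg_pos {G : SimpleGraph V} {u v : V} (h : G.Adj u v) : 0 < G.deg u :=
  (Set.ncard_pos).2 ⟨v, h⟩

theorem size_deleteIncidenceSet_lt {G : SimpleGraph V} {u v : V} (h : G.Adj u v) :
    (G.deleteIncidenceSet u).size < G.size := by
  have := G.size_deleteIncidenceSet_add u
  have := deg_pos h
  omega

theorem deg_deleteIncidenceSet_of_adj {G : SimpleGraph V} {u v : V} (h : G.Adj u v) :
    (G.deleteIncidenceSet u).deg v + 1 = G.deg v := by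
  rw [deg, deg, ← Set.ncard_sdiff_singleton_add_one (a := u) (s := G.neighborSet v) h.symm]
  congr 2
  ext x
  simp [deleteIncidenceSet_adj, h.ne']

theorem deg_eq_three_of_adj {G : SimpleGraph V} {v a : V} (h : G.deg v = 3) (ha : G.Adj v a) :
    ∃ b c, a ≠ b ∧ a ≠ c ∧ b ≠ c ∧ ∀ y, G.Adj v y ↔ y = a ∨ y = b ∨ y = c := by
  have h1 := deg_deleteIncidenceSet_of_adj ha.symm
  obtain ⟨b, c, hbc, hv⟩ := deg_eq_two (G := G.deleteIncidenceSet a) (v := v) (by omega)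
  simp only [deleteIncidenceSet_adj] at hv
  have := ha.ne
  refine ⟨b, c, ?_, ?_, hbc, ?_⟩ <;> grind

theorem deg_eq_three_of_adj_of_adj {G : SimpleGraph V} {v a b : V} (h : G.deg v = 3)
    (ha : G.Adj v a) (hb : G.Adj v b) (hab : a ≠ b) :
    ∃ c, a ≠ c ∧ b ≠ c ∧ ∀ y, G.Adj v y ↔ y = a ∨ y = b ∨ y = c := by
  obtain ⟨c, d, h1, h2, h3, hv⟩ := deg_eq_three_of_adj h ha
  rcases (hv b).1 hb with rfl | rfl | rfl
  · exact absurd rfl hab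
  · exact ⟨d, h2, h3, hv⟩
  · exact ⟨c, h1, h3.symm, fun y => by rw [hv]; tauto⟩

theorem deg_eq_four_of_adj_of_adj {G : SimpleGraph V} {v a b : V} (h : G.deg v = 4)
    (ha : G.Adj v a) (hb : G.Adj v b) (hab : a ≠ b) :
    ∃ c d, a ≠ c ∧ b ≠ c ∧ a ≠ d ∧ b ≠ d ∧ c ≠ d ∧
      ∀ y, G.Adj v y ↔ y = a ∨ y = b ∨ y = c ∨ y = d := by
  have h1 := deg_deleteIncidenceSet_of_adj ha.symm
  obtain ⟨c, d, h2, h3, h4, hv⟩ := deg_eq_three_of_adj (G := G.deleteIncidenceSet a) (v := v)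
    (a := b) (by omega) (by rw [deleteIncidenceSet_adj]; exact ⟨hb, ha.ne, hab.symm⟩)
  simp only [deleteIncidenceSet_adj] at hv
  have := ha.ne
  refine ⟨c, d, ?_, ?_, ?_, ?_, ?_, ?_⟩ <;> grind

/-- Deleting a vertex. -/
theorem HasSlack.delete {G : SimpleGraph V} {v : V} {s : ℤ}
    (h : (G.deleteIncidenceSet v).HasSlack s) : G.HasSlack (s + 2 * G.deg v - 9) := by
  classical
  obtain ⟨R, f, h1, h2⟩ := h
  refine ⟨insert v R, f, fun x y hxy => ?_, ?_⟩
  · have := h1 x y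
    rw [deleteIncidenceSet_adj] at this
    simp only [Finset.mem_insert]
    tauto
  · have := Finset.card_insert_le v R
    have := G.size_deleteIncidenceSet_add v
    omega

/-- Keeping a vertex with at most one neighbor. -/
theorem HasSlack.pendant {G : SimpleGraph V} {v a : V} {s : ℤ}
    (h : (G.deleteIncidenceSet v).HasSlack s) (hv : ∀ y, G.Adj v y ↔ y = a) :
    G.HasSlack (s + 2) := by
  classical
  obtain ⟨R, f, h1, h2⟩ := h
  refine ⟨R, Function.update f v a, fun x y hxy => ?_, ?_⟩
  · have := h1 x y
    rw [deleteIncidenceSet_adj] at this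
    simp only [Function.update_apply]
    have := hxy.symm
    grind
  · have := G.size_deleteIncidenceSet_add v
    have := deg_pos ((hv a).2 rfl)
    omega

/-- Keeping an isolated triangle. -/
theorem HasSlack.triangle {G : SimpleGraph V} {x a b : V} {s : ℤ}
    (h : (((G.deleteIncidenceSet x).deleteIncidenceSet a).deleteIncidenceSet b).HasSlack s)
    (hxa : G.Adj x a) (hxb : G.Adj x b) (hab : G.Adj a b)
    (hx : ∀ y, G.Adj x y → y = a ∨ y = b) (ha : ∀ y, G.Adj a y → y = x ∨ y = b)
    (hb : ∀ y, G.Adj b y → y = x ∨ y = a) : G.HasSlack (s + 6) := by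
  classical
  have hxd : 2 ≤ G.deg x := by
    rw [deg, ← Set.ncard_pair hab.ne]
    exact Set.ncard_le_ncard (by rintro y (rfl | rfl) <;> assumption)
  have had : 1 ≤ (G.deleteIncidenceSet x).deg a := by
    apply deg_pos (v := b)
    rw [deleteIncidenceSet_adj]
    exact ⟨hab, hxa.ne', hxb.ne'⟩
  obtain ⟨R, f, h1, h2⟩ := h
  refine ⟨R, Function.update (Function.update (Function.update f x a) a b) b x,
    fun y z hyz => ?_, ?_⟩
  · have := h1 y z
    simp only [deleteIncidenceSet_adj] at this
    simp only [Function.update_apply]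
    have := hyz.symm
    have := hxa.ne
    have := hxb.ne
    have := hab.ne
    grind
  · have := G.size_deleteIncidenceSet_add x
    have := (G.deleteIncidenceSet x).size_deleteIncidenceSet_add a
    have := ((G.deleteIncidenceSet x).deleteIncidenceSet a).size_deleteIncidenceSet_le b
    omega

theorem size_suppress_add_one {G : SimpleGraph V} {w a b : V} (hab : a ≠ b)
    (hnab : ¬ G.Adj a b) (hw : ∀ y, G.Adj w y ↔ y = a ∨ y = b) :
    (G.suppress w a b).size + 1 = G.size := by
  have h1 : G.deg w = 2 := by
    rw [deg, ← Set.ncard_pair hab]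
    congr 1
    ext y
    simp [hw]
  have h2 := G.size_deleteIncidenceSet_add w
  have h3 : (G.suppress w a b).edgeSet = insert s(a, b) (G.deleteIncidenceSet w).edgeSet := by
    rw [suppress, edgeSet_sup, edgeSet_edge_of_ne hab, Set.union_singleton]
  have h4 : (G.suppress w a b).size = (G.deleteIncidenceSet w).size + 1 := by
    rw [size, h3, Set.ncard_insert_of_notMem, size]
    rw [mem_edgeSet, deleteIncidenceSet_adj]
    tauto
  omega

/-- In the cubic case this keeps a second vertex of degree 2 available after a suppression. -/
theorem deg_suppress {G : SimpleGraph V} {w a b : V} (hab : a ≠ b)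
    (hnab : ¬ G.Adj a b) (hw : ∀ y, G.Adj w y ↔ y = a ∨ y = b) {x : V} (hx : x ≠ w) :
    (G.suppress w a b).deg x = G.deg x := by
  have key : ∀ a b, a ≠ b → ¬ G.Adj a b → (∀ y, G.Adj w y ↔ y = a ∨ y = b) →
      (G.suppress w a b).deg a = G.deg a := by
    intro a b hab hnab hw
    have hwa := (hw a).2 (Or.inl rfl)
    rw [← deg_deleteIncidenceSet_of_adj hwa]
    have : (G.suppress w a b).neighborSet a =
        insert b ((G.deleteIncidenceSet w).neighborSet a) := by
      ext y
      simp only [mem_neighborSet, suppress_adj hab, deleteIncidenceSet_adj, Set.mem_insert_iff]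
      grind
    rw [deg, this, Set.ncard_insert_of_notMem, deg]
    simp only [mem_neighborSet, deleteIncidenceSet_adj]
    tauto
  by_cases hxa : x = a
  · rw [hxa]; exact key a b hab hnab hw
  by_cases hxb : x = b
  · have : G.suppress w a b = G.suppress w b a := by rw [suppress, suppress, edge_comm]
    rw [hxb, this]
    exact key b a hab.symm (fun h => hnab h.symm) (fun y => by rw [hw, or_comm])
  rw [deg, deg]
  congr 1
  ext y
  simp only [mem_neighborSet, suppress_adj hab]
  have := hw x
  grind [Adj.symm]

/-- Suppressing a vertex with two nonadjacent neighbors. -/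
theorem HasSlack.suppress {G : SimpleGraph V} {w a b : V} {s : ℤ}
    (h : (G.suppress w a b).HasSlack s) (hab : a ≠ b)
    (hnab : ¬ G.Adj a b) (hw : ∀ y, G.Adj w y ↔ y = a ∨ y = b) : G.HasSlack (s + 2) := by
  classical
  have hsize := size_suppress_add_one hab hnab hw
  have hwa := ((hw a).2 (Or.inl rfl)).ne
  have hwb := ((hw b).2 (Or.inr rfl)).ne
  obtain ⟨R, f, h1, h2⟩ := h
  have hf := h1 a b ((suppress_adj hab).2 (by simp))
  simp only [suppress_adj hab] at h1
  -- If `ab` is oriented, the path through `w` inherits its direction. Otherwise one end lies in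
  -- `R`, and `w` points to the other.
  by_cases hfa : f a = b
  · refine ⟨R, Function.update (Function.update f a w) w b, fun x y hxy => ?_, by omega⟩
    have := h1 x y
    have := hxy.symm
    simp only [Function.update_apply]
    grind
  by_cases hfb : f b = a
  · refine ⟨R, Function.update (Function.update f b w) w a, fun x y hxy => ?_, by omega⟩
    have := h1 x y
    have := hxy.symm
    simp only [Function.update_apply]
    grind
  by_cases ha : a ∈ R
  · refine ⟨R, Function.update f w b, fun x y hxy => ?_, by omega⟩
    have := h1 x y
    have := hxy.symm
    simp only [Function.update_apply]
    grind
  · refine ⟨R, Function.update f w a, fun x y hxy => ?_, by omega⟩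
    have := h1 x y
    have := hxy.symm
    simp only [Function.update_apply]
    grind

end Moves

/-! ### Degrees 1, 2 and at least 5 -/

section Reduction

variable {V : Type*} [Finite V] {G : SimpleGraph V} {n : ℕ}

theorem deg_le_deg_deleteIncidenceSet_add_one {u v : V} (huv : u ≠ v) :
    G.deg v ≤ (G.deleteIncidenceSet u).deg v + 1 := by
  by_cases h : G.Adj u v
  · exact (deg_deleteIncidenceSet_of_adj h).ge
  · rw [deg_deleteIncidenceSet_of_not_adj huv h]
    omega

/-- Asking only `G.size ≤ n` lets this and the later lemmas be applied after a deletion, under the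
same induction hypothesis. -/
theorem hasSlack_of_isolated_triangle (ih : ∀ H : SimpleGraph V, H.size < n → H.HasSlack 0)
    (hn : G.size ≤ n) {x a b : V} (hxa : G.Adj x a) (hxb : G.Adj x b) (hab : G.Adj a b)
    (hx : ∀ y, G.Adj x y → y = a ∨ y = b) (ha : ∀ y, G.Adj a y → y = x ∨ y = b)
    (hb : ∀ y, G.Adj b y → y = x ∨ y = a) : G.HasSlack 6 := by
  refine (HasSlack.triangle (ih _ ?_) hxa hxb hab hx ha hb).mono (by norm_num)
  exact (((size_deleteIncidenceSet_le _ _).trans (size_deleteIncidenceSet_le _ _)).trans_lt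
    (size_deleteIncidenceSet_lt hxa)).trans_le hn

/-- Deleting `z` isolates the triangle: `(2 deg z - 9) + 6`. -/
theorem hasSlack_of_triangle_of_cut (ih : ∀ H : SimpleGraph V, H.size < n → H.HasSlack 0)
    (hn : G.size ≤ n) {x a b z : V} (hxa : G.Adj x a) (hxb : G.Adj x b) (hab : G.Adj a b)
    (hzx : z ≠ x) (hza : z ≠ a) (hzb : z ≠ b)
    (hx : ∀ y, G.Adj x y → y = a ∨ y = b ∨ y = z) (ha : ∀ y, G.Adj a y → y = x ∨ y = b ∨ y = z)
    (hb : ∀ y, G.Adj b y → y = x ∨ y = a ∨ y = z) : G.HasSlack (2 * G.deg z - 3) := by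
  have h := hasSlack_of_isolated_triangle ih ((size_deleteIncidenceSet_le G z).trans hn)
    (x := x) (a := a) (b := b)
  simp only [deleteIncidenceSet_adj] at h
  refine (HasSlack.delete (v := z) (h ?_ ?_ ?_ ?_ ?_ ?_)).mono (by omega) <;> grind

/-- A vertex of degree `1`, `2` or at least `5` yields a reduction with some gain. -/
theorem hasSlack_one_of_deg (ih : ∀ H : SimpleGraph V, H.size < n → H.HasSlack 0)
    (hn : G.size ≤ n) {v : V} (h0 : G.deg v ≠ 0) (h3 : G.deg v ≠ 3) (h4 : G.deg v ≠ 4) :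
    G.HasSlack 1 := by
  have hlt : ∀ {u w}, G.Adj u w → (G.deleteIncidenceSet u).size < n := fun h =>
    (size_deleteIncidenceSet_lt h).trans_le hn
  by_cases h5 : ∃ u, 5 ≤ G.deg u
  · obtain ⟨u, hu⟩ := h5
    obtain ⟨w, hw⟩ := (Set.ncard_pos).1 (show 0 < (G.neighborSet u).ncard by
      change 0 < G.deg u; omega)
    exact (ih _ (hlt hw)).delete.mono (by omega)
  by_cases h1 : ∃ u, G.deg u = 1
  · obtain ⟨u, hu⟩ := h1
    obtain ⟨a, ha⟩ := deg_eq_one hu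
    exact ((ih _ (hlt ((ha a).2 rfl))).pendant ha).mono (by omega)
  push Not at h5 h1
  have hpos : ∀ {x y}, G.Adj x y → 2 ≤ G.deg x := fun {x y} h => by
    have := deg_pos h
    have := h1 x
    omega
  obtain ⟨a, b, hab, hv⟩ := deg_eq_two (G := G) (v := v) (by have := h5 v; have := h1 v; omega)
  have hva : G.Adj v a := (hv a).2 (Or.inl rfl)
  have hvb : G.Adj v b := (hv b).2 (Or.inr rfl)
  by_cases hadj : G.Adj a b
  swap
  · refine ((ih (G.suppress v a b) ?_).suppress hab hadj hv).mono (by norm_num)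
    have := size_suppress_add_one hab hadj hv
    omega
  -- a neighbor of degree four
  have big : ∀ a b, G.Adj v a → G.Adj v b → G.Adj a b → (∀ y, G.Adj v y ↔ y = a ∨ y = b) →
      G.deg a = 4 → G.HasSlack 1 := by
    intro a b hva hvb hab hv ha
    refine (HasSlack.delete (v := a) (HasSlack.pendant (v := v) (a := b) (ih _ ?_) ?_)).mono ?_
    · exact (size_deleteIncidenceSet_le _ _).trans_lt (hlt hab)
    · intro y
      rw [deleteIncidenceSet_adj, hv]
      have := hva.ne
      have := hab.ne
      grind
    · omega
  by_cases ha4 : G.deg a = 4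
  · exact big a b hva hvb hadj hv ha4
  by_cases hb4 : G.deg b = 4
  · exact big b a hvb hva hadj.symm (fun y => by rw [hv, or_comm]) hb4
  -- the triangle is attached at a single vertex
  have cut : ∀ z, z ≠ v → z ≠ a → z ≠ b → (∃ y, G.Adj z y) →
      (∀ y, G.Adj a y → y = v ∨ y = b ∨ y = z) → (∀ y, G.Adj b y → y = v ∨ y = a ∨ y = z) →
      G.HasSlack 1 := by
    rintro z hzv hza hzb ⟨y, hy⟩ ha hb
    refine (hasSlack_of_triangle_of_cut ih hn hva hvb hadj hzv hza hzb ?_ ha hb).mono ?_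
    · intro y hy
      have := (hv y).1 hy
      tauto
    · have := hpos hy
      omega
  have nbhd : ∀ a b, G.Adj v a → G.Adj a b → v ≠ b → G.deg a ≠ 4 →
      (∀ y, G.Adj a y ↔ y = v ∨ y = b) ∨
      ∃ c, v ≠ c ∧ b ≠ c ∧ ∀ y, G.Adj a y ↔ y = v ∨ y = b ∨ y = c := by
    intro a b hva hab hvb ha4
    have := hpos hab
    have := h5 a
    rcases (show G.deg a = 2 ∨ G.deg a = 3 by omega) with h2 | h2
    · left
      obtain ⟨c, hc, h⟩ := deg_eq_two_of_adj h2 hva.symm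
      grind
    · right
      exact deg_eq_three_of_adj_of_adj h2 hva.symm hab hvb
  rcases nbhd a b hva hadj hvb.ne ha4 with ha | ⟨a', ha1, ha2, ha⟩
  · rcases nbhd b a hvb hadj.symm hva.ne hb4 with hb | ⟨b', hb1, hb2, hb⟩
    · refine (hasSlack_of_isolated_triangle ih hn hva hvb hadj ?_ ?_ ?_).mono (by norm_num) <;>
        grind
    · have hbb : G.Adj b b' := by simp [hb]
      refine cut b' hb1.symm hb2.symm hbb.ne' ⟨b, hbb.symm⟩ ?_ ?_ <;> grind
  · have haa : G.Adj a a' := by simp [ha]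
    rcases nbhd b a hvb hadj.symm hva.ne hb4 with hb | ⟨b', hb1, hb2, hb⟩
    · refine cut a' ha1.symm haa.ne' ha2.symm ⟨a, haa.symm⟩ ?_ ?_ <;> grind
    · have hbb : G.Adj b b' := by simp [hb]
      by_cases hab' : a' = b'
      · subst hab'
        refine cut a' ha1.symm haa.ne' ha2.symm ⟨a, haa.symm⟩ ?_ ?_ <;> grind
      -- Here `a` has degree at least 3, so its deletion costs at most 3; then `v` and `b`
      -- successively become pendant and gain 2 each.
      · refine (HasSlack.delete (v := a) (HasSlack.pendant (v := v) (a := b)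
          (HasSlack.pendant (v := b) (a := b') (ih _ ?_) ?_) ?_)).mono ?_
        · exact ((size_deleteIncidenceSet_le _ _).trans (size_deleteIncidenceSet_le _ _)).trans_lt
            (hlt haa)
        · intro y
          simp only [deleteIncidenceSet_adj, hb]
          have := hvb.ne
          have := hadj.ne
          grind
        · intro y
          simp only [deleteIncidenceSet_adj, hv]
          have := hva.ne
          grind
        · have : 3 ≤ G.deg a := by
            have hs : ({v, b, a'} : Set V) ⊆ G.neighborSet a := by
              rintro y (rfl | rfl | rfl) <;> simp [ha]
            have := Set.ncard_le_ncard hs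
            rwa [Set.ncard_eq_three.2 ⟨v, b, a', hvb.ne, ha1, ha2, rfl⟩] at this
          omega

end Reduction

/-! ### A vertex of degree 4 next to one of degree 3 -/

section Mixed

variable {V : Type*} [Finite V] {G : SimpleGraph V} {n : ℕ}

/-- Deleting a vertex of degree four makes its neighbor `w` of degree three suppressible. -/
theorem hasSlack_one_of_suppress (ih : ∀ H : SimpleGraph V, H.size < n → H.HasSlack 0)
    (hn : G.size ≤ n) {v w a b : V} (hv : G.deg v = 4) (hva : v ≠ a) (hvb : v ≠ b) (hab : a ≠ b)
    (hw : ∀ y, G.Adj w y ↔ y = v ∨ y = a ∨ y = b) (hnab : ¬ G.Adj a b) : G.HasSlack 1 := by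
  have hwv : G.Adj w v := by simp [hw]
  have hw' : ∀ y, (G.deleteIncidenceSet v).Adj w y ↔ y = a ∨ y = b := by
    intro y
    rw [deleteIncidenceSet_adj, hw]
    have := hwv.ne
    grind
  have hnab' : ¬ (G.deleteIncidenceSet v).Adj a b := fun h => hnab (deleteIncidenceSet_le _ _ h)
  refine (HasSlack.delete (v := v) (HasSlack.suppress (ih _ ?_) hab hnab' hw')).mono (by omega)
  have := size_suppress_add_one hab hnab' hw'
  have := size_deleteIncidenceSet_lt hwv.symm
  omega

/-- Deleting `v` and `p` costs 1 each. Then `q` still has degree at least 3 and alone attaches the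
triangle, which gains at least 3. -/
theorem hasSlack_one_of_triangle_of_three (ih : ∀ H : SimpleGraph V, H.size < n → H.HasSlack 0)
    (hn : G.size ≤ n) {w a b v p q : V} (hwa : G.Adj w a) (hwb : G.Adj w b) (hab : G.Adj a b)
    (hd : [w, a, b, v, p, q].Nodup)
    (hw : ∀ y, G.Adj w y → y ∈ [a, b, v, p, q]) (ha : ∀ y, G.Adj a y → y ∈ [w, b, v, p, q])
    (hb : ∀ y, G.Adj b y → y ∈ [w, a, v, p, q])
    (hv : G.deg v = 4) (hp : G.deg p = 4) (hq : G.deg q = 4)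
    (hvp : ¬ G.Adj v p) (hvq : ¬ G.Adj v q) : G.HasSlack 1 := by
  have h := hasSlack_of_triangle_of_cut (G := (G.deleteIncidenceSet v).deleteIncidenceSet p)
    (x := w) (a := a) (b := b) (z := q) ih
    (((size_deleteIncidenceSet_le _ _).trans (size_deleteIncidenceSet_le _ _)).trans hn)
  simp only [deleteIncidenceSet_adj] at h
  simp only [List.nodup_cons, List.mem_cons, List.not_mem_nil, not_or] at hd hw ha hb
  have hvp' : (G.deleteIncidenceSet v).deg p = 4 := by
    rw [deg_deleteIncidenceSet_of_not_adj (by tauto) hvp, hp]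
  have hvq' : (G.deleteIncidenceSet v).deg q = 4 := by
    rw [deg_deleteIncidenceSet_of_not_adj (by tauto) hvq, hq]
  have := deg_le_deg_deleteIncidenceSet_add_one (G := G.deleteIncidenceSet v) (u := p) (v := q)
    (by tauto)
  refine (HasSlack.delete (v := v) (HasSlack.delete (v := p)
    (h ?_ ?_ ?_ ?_ ?_ ?_ ?_ ?_ ?_))).mono (by omega) <;> clear h <;> grind

/-- A vertex of degree four with a neighbor of degree three yields a reduction with some gain,
unless they lie in a nearly complete graph on five vertices. -/
theorem hasSlack_one_of_adj_of_deg (ih : ∀ H : SimpleGraph V, H.size < n → H.HasSlack 0)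
    (hn : G.size ≤ n) (hdeg : ∀ x, G.deg x = 0 ∨ G.deg x = 3 ∨ G.deg x = 4) {v w : V}
    (hv : G.deg v = 4) (hw : G.deg w = 3) (hvw : G.Adj v w) :
    G.HasSlack 1 ∨ ((∀ y, G.Adj w y → y = v ∨ G.Adj v y) ∧
      ∃ a, G.Adj w a ∧ a ≠ v ∧ G.deg a = 4) := by
  have hle : ∀ u, (G.deleteIncidenceSet u).size ≤ n := fun u =>
    (size_deleteIncidenceSet_le _ _).trans hn
  have hdeg' : ∀ {x y}, G.Adj x y → G.deg x = 3 ∨ G.deg x = 4 := fun {x y} h => by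
    have := deg_pos h
    have := hdeg x
    omega
  obtain ⟨a, b, hva, hvb, hab, hwN⟩ := deg_eq_three_of_adj hw hvw.symm
  have hwa : G.Adj w a := by simp [hwN]
  have hwb : G.Adj w b := by simp [hwN]
  have hwv := hvw.symm
  by_cases hadj : G.Adj a b
  swap
  · exact Or.inl (hasSlack_one_of_suppress ih hn hv hva hvb hab hwN hadj)
  -- `a` and `b` are both adjacent to `v`
  by_cases hboth : G.Adj v a ∧ G.Adj v b
  · by_cases ha4 : G.deg a = 4
    · exact Or.inr ⟨by grind, a, hwa, hva.symm, ha4⟩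
    by_cases hb4 : G.deg b = 4
    · exact Or.inr ⟨by grind, b, hwb, hvb.symm, hb4⟩
    left
    have ha3 : G.deg a = 3 := by have := hdeg' hadj; omega
    have hb3 : G.deg b = 3 := by have := hdeg' hadj.symm; omega
    obtain ⟨a', ha1, ha2, haN⟩ := deg_eq_three_of_adj_of_adj ha3 hwa.symm hadj hwb.ne
    obtain ⟨b', hb1, hb2, hbN⟩ := deg_eq_three_of_adj_of_adj hb3 hwb.symm hadj.symm hwa.ne
    have hav := (haN v).1 hboth.1.symm
    have hbv := (hbN v).1 hboth.2.symm
    have h := hasSlack_of_isolated_triangle (G := G.deleteIncidenceSet v) (x := w) (a := a)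
      (b := b) ih (hle v)
    simp only [deleteIncidenceSet_adj] at h
    refine (HasSlack.delete (v := v) (h ?_ ?_ ?_ ?_ ?_ ?_)).mono (by omega) <;> clear h <;> grind
  left
  -- by symmetry, `b` is not adjacent to `v`
  wlog hvb' : ¬ G.Adj v b generalizing a b
  · exact this b a hvb hva hab.symm (fun y => by rw [hwN]; tauto) hwb hwa hadj.symm
      (by tauto) (by tauto)
  clear hboth
  by_cases hva' : G.Adj v a
  · rcases hdeg' hadj with ha3 | ha4
    swap
    · exact hasSlack_one_of_suppress (v := a) (w := w) (a := v) (b := b) ih hn ha4 hva.symm hab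
        hvb (fun y => by rw [hwN]; tauto) hvb'
    have haN : ∀ y, G.Adj a y ↔ y = w ∨ y = b ∨ y = v := by
      obtain ⟨a', ha1, ha2, haN⟩ := deg_eq_three_of_adj_of_adj ha3 hwa.symm hadj hwb.ne
      have hav := (haN v).1 hva'.symm
      have := hvw.ne
      grind
    rcases hdeg' hadj.symm with hb3 | hb4
    · obtain ⟨z, hb1, hb2, hbN⟩ := deg_eq_three_of_adj_of_adj hb3 hwb.symm hadj.symm hwa.ne
      have hbz : G.Adj b z := by simp [hbN]
      have hzv : z ≠ v := by
        rintro rfl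
        exact hvb' hbz.symm
      -- If so, deleting `v` makes `z` suppressible. If not, `z` has degree at least 3 in `G - v`,
      -- and cutting off the triangle there gains at least 3.
      by_cases hz : G.deg z = 3 ∧ G.Adj v z
      · obtain ⟨y, hy1, hy2, hzN⟩ := deg_eq_three_of_adj_of_adj hz.1 hz.2.symm hbz.symm hvb
        have hzy : G.Adj z y := by simp [hzN]
        refine hasSlack_one_of_suppress ih hn hv hvb hy1 hy2 hzN ?_
        intro hby
        rcases (hbN y).1 hby with rfl | rfl | rfl
        · have := (hwN z).1 hzy.symm
          have := hbz.ne
          grind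
        · have := (haN z).1 hzy.symm
          have := hbz.ne
          grind
        · exact hzy.ne rfl
      · have h := hasSlack_of_triangle_of_cut (G := G.deleteIncidenceSet v) (x := w) (a := a)
          (b := b) (z := z) ih (hle v)
        simp only [deleteIncidenceSet_adj] at h
        have hz3 : 3 ≤ (G.deleteIncidenceSet v).deg z := by
          have := deg_le_deg_deleteIncidenceSet_add_one (G := G) hzv.symm
          by_cases hvz : G.Adj v z
          · have := hdeg' hbz.symm
            have := deg_deleteIncidenceSet_of_adj hvz
            have : G.deg z ≠ 3 := fun h => hz ⟨h, hvz⟩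
            omega
          · have := hdeg' hbz.symm
            rw [deg_deleteIncidenceSet_of_not_adj hzv.symm hvz]
            omega
        have := hvw.ne
        have := hbz.ne
        refine (HasSlack.delete (v := v) (h ?_ ?_ ?_ ?_ ?_ ?_ ?_ ?_ ?_)).mono (by omega) <;>
          clear h <;> grind
    · obtain ⟨p, q, hp1, hp2, hq1, hq2, hpq, hbN⟩ :=
        deg_eq_four_of_adj_of_adj hb4 hwb.symm hadj.symm hwa.ne
      -- Deleting `v` and `b` costs 2, repaid by the pendant `w`; unless `p` has degree 4 and misses
      -- `v`, it is left with degree 1 or 2, which gains 1.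
      have key : ∀ p, p ≠ w → p ≠ a → G.Adj b p → (G.deg p = 4 ∧ ¬ G.Adj v p) ∨
          G.HasSlack 1 := by
        intro p hpw hpa hbp
        by_contra hcon
        push Not at hcon
        refine hcon.2 ?_
        have hpv : v ≠ p := by
          rintro rfl
          exact hvb' hbp.symm
        have h1 : (G.deleteIncidenceSet v).Adj b p := by
          rw [deleteIncidenceSet_adj]
          exact ⟨hbp, hvb.symm, hpv.symm⟩
        have h2 := deg_deleteIncidenceSet_of_adj h1
        have h3 : ¬ ((G.deleteIncidenceSet v).deleteIncidenceSet b).Adj w p := by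
          simp only [deleteIncidenceSet_adj, hwN]
          grind
        have h4 := deg_deleteIncidenceSet_of_not_adj hpw.symm h3
        have h5 : (G.deleteIncidenceSet v).deg p = 2 ∨ (G.deleteIncidenceSet v).deg p = 3 := by
          have := hdeg' hbp.symm
          by_cases hvp : G.Adj v p
          · have := deg_deleteIncidenceSet_of_adj hvp
            omega
          · rw [deg_deleteIncidenceSet_of_not_adj hpv hvp]
            have := hcon.1
            tauto
        have h6 : (G.deleteIncidenceSet v).deg b = 4 := by
          rw [deg_deleteIncidenceSet_of_not_adj hvb hvb', hb4]
        refine (HasSlack.delete (v := v) (HasSlack.delete (v := b) (HasSlack.pendant (v := w)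
          (a := a) (hasSlack_one_of_deg (v := p) ih ?_ ?_ ?_ ?_) ?_))).mono ?_
        · exact (size_deleteIncidenceSet_le _ _).trans
            ((size_deleteIncidenceSet_le _ _).trans (hle v))
        · omega
        · omega
        · omega
        · intro y
          simp only [deleteIncidenceSet_adj, hwN]
          have := hvw.ne
          have := hwb.ne
          grind
        · omega
      have hbp : G.Adj b p := by simp [hbN]
      have hbq : G.Adj b q := by simp [hbN]
      rcases key p hp1.symm hp2.symm hbp with hp | h
      swap
      · exact h
      rcases key q hq1.symm hq2.symm hbq with hq | h
      swap
      · exact h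
      refine hasSlack_one_of_triangle_of_three (v := v) (p := p) (q := q) ih hn hwa hwb hadj ?_
        ?_ ?_ ?_ hv hp.1 hq.1 hp.2 hq.2
      · simp only [List.nodup_cons, List.mem_cons, List.not_mem_nil, not_or]
        have := hwa.ne
        have := hwb.ne
        have := hbp.ne
        have := hbq.ne
        have := hvw.ne
        have : ¬ G.Adj b v := fun h => hvb' h.symm
        refine ⟨?_, ?_, ?_, ?_, ?_, ?_⟩ <;> grind
      all_goals
        intro y hy
        simp only [List.mem_cons, List.not_mem_nil]
        grind
  -- neither `a` nor `b` is adjacent to `v`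
  have big : ∀ a b, G.Adj w a → G.Adj w b → a ≠ v → b ≠ v → ¬ G.Adj v a → ¬ G.Adj v b →
      G.Adj a b → (∀ y, G.Adj w y ↔ y = v ∨ y = a ∨ y = b) → G.deg a = 4 → G.HasSlack 1 := by
    intro a b hwa hwb hav hbv hva' hvb' hab hwN ha4
    have h1 : (G.deleteIncidenceSet v).deg a = 4 := by
      rw [deg_deleteIncidenceSet_of_not_adj hav.symm hva', ha4]
    have h2 : (G.deleteIncidenceSet v).deg b = G.deg b :=
      deg_deleteIncidenceSet_of_not_adj hbv.symm hvb'
    have h3 := deg_deleteIncidenceSet_of_adj (G := G.deleteIncidenceSet v) (u := a) (v := b)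
      (by rw [deleteIncidenceSet_adj]; exact ⟨hab, hav, hbv⟩)
    have h4 := deg_deleteIncidenceSet_of_adj
      (G := (G.deleteIncidenceSet v).deleteIncidenceSet a) (u := w) (v := b)
      (by simp only [deleteIncidenceSet_adj]; exact ⟨⟨hwb, hvw.ne', hbv⟩, hwa.ne, hab.ne'⟩)
    have h5 := hdeg' hab.symm
    -- The two deletions cost 2 and the pendant `w` gains 2; `b` has lost `a` and `w`, so its degree
    -- is 1 or 2.
    refine (HasSlack.delete (v := v) (HasSlack.delete (v := a) (HasSlack.pendant (v := w)
      (a := b) (hasSlack_one_of_deg (v := b) ih ?_ ?_ ?_ ?_) ?_))).mono ?_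
    · exact (size_deleteIncidenceSet_le _ _).trans
        ((size_deleteIncidenceSet_le _ _).trans (hle v))
    · omega
    · omega
    · omega
    · intro y
      simp only [deleteIncidenceSet_adj, hwN]
      have := hvw.ne
      have := hwa.ne
      have := hab.ne
      grind
    · omega
  rcases hdeg' hadj with ha3 | ha4
  swap
  · exact big a b hwa hwb hva.symm hvb.symm hva' hvb' hadj hwN ha4
  rcases hdeg' hadj.symm with hb3 | hb4
  swap
  · exact big b a hwb hwa hvb.symm hva.symm hvb' hva' hadj.symm
      (fun y => by rw [hwN]; tauto) hb4
  obtain ⟨a', ha1, ha2, haN⟩ := deg_eq_three_of_adj_of_adj ha3 hwa.symm hadj hwb.ne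
  obtain ⟨b', hb1, hb2, hbN⟩ := deg_eq_three_of_adj_of_adj hb3 hwb.symm hadj.symm hwa.ne
  have haa : G.Adj a a' := by simp [haN]
  have hbb : G.Adj b b' := by simp [hbN]
  have hav : a' ≠ v := by
    rintro rfl
    exact hva' haa.symm
  have hbv : b' ≠ v := by
    rintro rfl
    exact hvb' hbb.symm
  have hda : (G.deleteIncidenceSet v).deg a = 3 := by
    rw [deg_deleteIncidenceSet_of_not_adj hva hva', ha3]
  by_cases hab' : a' = b'
  · subst hab'
    rename' a' => z
    by_cases hz : G.deg z = 3 ∧ G.Adj v z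
    · have hzN : ∀ y, G.Adj z y ↔ y = v ∨ y = a ∨ y = b := by
        obtain ⟨c, hc1, hc2, hzN⟩ := deg_eq_three_of_adj_of_adj hz.1 hz.2.symm haa.symm hva
        have := (hzN b).1 hbb.symm
        grind
      obtain ⟨x, y, hx1, hx2, hy1, hy2, hxy, hvN⟩ :=
        deg_eq_four_of_adj_of_adj hv hvw hz.2 ha1
      -- If `x` has degree 3: deleting `v` and `a` costs 1 + 3, the pendants `w` and `z` gain 4, and
      -- `x` is left with degree 2.
      have key : ∀ x, x ≠ w → x ≠ z → G.Adj v x → G.deg x = 4 ∨ G.HasSlack 1 := by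
        intro x hxw hxz hvx
        by_contra hcon
        push Not at hcon
        refine hcon.2 ?_
        have hxa : a ≠ x := by rintro rfl; exact hva' hvx
        have hxb : b ≠ x := by rintro rfl; exact hvb' hvx
        have hx3 : G.deg x = 3 := by
          have := hdeg' hvx.symm
          tauto
        have h1 := deg_deleteIncidenceSet_of_adj hvx
        have h2 : ((G.deleteIncidenceSet v).deleteIncidenceSet a).deg x = _ :=
          deg_deleteIncidenceSet_of_not_adj hxa (by
            simp only [deleteIncidenceSet_adj, haN]
            grind)
        have h3 : (((G.deleteIncidenceSet v).deleteIncidenceSet a).deleteIncidenceSet w).deg x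
            = _ := deg_deleteIncidenceSet_of_not_adj hxw.symm (by
              simp only [deleteIncidenceSet_adj, hwN]
              grind)
        have h4 : ((((G.deleteIncidenceSet v).deleteIncidenceSet a).deleteIncidenceSet
            w).deleteIncidenceSet z).deg x = _ := deg_deleteIncidenceSet_of_not_adj hxz.symm (by
              simp only [deleteIncidenceSet_adj, hzN]
              grind)
        refine (HasSlack.delete (v := v) (HasSlack.delete (v := a) (HasSlack.pendant (v := w)
          (a := b) (HasSlack.pendant (v := z) (a := b)
            (hasSlack_one_of_deg (v := x) ih ?_ ?_ ?_ ?_) ?_) ?_))).mono ?_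
        · exact (size_deleteIncidenceSet_le _ _).trans ((size_deleteIncidenceSet_le _ _).trans
            ((size_deleteIncidenceSet_le _ _).trans (hle v)))
        · omega
        · omega
        · omega
        · intro y
          simp only [deleteIncidenceSet_adj, hzN]
          have := haa.ne
          have := hwb.ne
          grind
        · intro y
          simp only [deleteIncidenceSet_adj, hwN]
          have := hwa.ne
          have := hvw.ne
          grind
        · omega
      have hvx : G.Adj v x := by simp [hvN]
      have hvy : G.Adj v y := by simp [hvN]
      rcases key x hx1.symm hx2.symm hvx with hx4 | h
      swap
      · exact h
      rcases key y hy1.symm hy2.symm hvy with hy4 | h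
      swap
      · exact h
      have hxa : x ≠ a := by rintro rfl; exact hva' hvx
      have hya : y ≠ a := by rintro rfl; exact hva' hvy
      have hxb : x ≠ b := by rintro rfl; exact hvb' hvx
      have hyb : y ≠ b := by rintro rfl; exact hvb' hvy
      have h1 := deg_le_deg_deleteIncidenceSet_add_one (G := G) hxy
      have h2 : (G.deleteIncidenceSet x).deg a = 3 := by
        rw [deg_deleteIncidenceSet_of_not_adj hxa, ha3]
        intro h
        have := (haN x).1 h.symm
        grind
      have h3 : ((G.deleteIncidenceSet x).deleteIncidenceSet y).deg a = 3 := by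
        rw [deg_deleteIncidenceSet_of_not_adj hya, h2]
        rw [deleteIncidenceSet_adj]
        intro h
        have := (haN y).1 h.1.symm
        grind
      have hwz : ¬ G.Adj w z := by
        rw [hwN]
        have := haa.ne
        have := hbb.ne
        grind
      -- These deletions cost at most 1 + 3 + 3 and leave the isolated 4-cycle `v w b z`.
      -- Suppressing `b` gains 2 and the resulting triangle gains 6.
      let K := ((G.deleteIncidenceSet x).deleteIncidenceSet y).deleteIncidenceSet a
      have hK : K.size ≤ n := (size_deleteIncidenceSet_le _ _).trans
        ((size_deleteIncidenceSet_le _ _).trans (hle x))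
      have hKwz : ¬ K.Adj w z := by
        simp only [K, deleteIncidenceSet_adj]
        tauto
      have := hvx.ne
      have := hvy.ne
      have := hwa.ne
      have := haa.ne
      have := hwb.ne
      have := hbb.ne
      have := hvw.ne
      have := hz.2.ne
      have hKb : ∀ t, K.Adj b t ↔ t = w ∨ t = z := by
        intro t
        simp only [K, deleteIncidenceSet_adj, hbN]
        grind
      have hsz := size_suppress_add_one ha1 hKwz hKb
      have h := hasSlack_of_isolated_triangle (G := K.suppress b w z) (x := w) (a := v) (b := z)
        ih (by omega)
      simp only [suppress_adj ha1, K, deleteIncidenceSet_adj] at h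
      refine (HasSlack.delete (v := x) (HasSlack.delete (v := y) (HasSlack.delete (v := a)
        (HasSlack.suppress (h ?_ ?_ ?_ ?_ ?_ ?_) ha1 hKwz hKb)))).mono (by omega) <;>
        clear h <;> grind
    · have hz3 : 3 ≤ (G.deleteIncidenceSet v).deg z := by
        have hz' := hdeg' haa.symm
        by_cases hvz : G.Adj v z
        · have := deg_deleteIncidenceSet_of_adj hvz
          have : G.deg z ≠ 3 := fun h => hz ⟨h, hvz⟩
          omega
        · rw [deg_deleteIncidenceSet_of_not_adj hav.symm hvz]
          omega
      have h := hasSlack_of_triangle_of_cut (G := G.deleteIncidenceSet v) (x := w) (a := a)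
        (b := b) (z := z) ih (hle v)
      simp only [deleteIncidenceSet_adj] at h
      have := hvw.ne
      have := haa.ne
      have := hbb.ne
      refine (HasSlack.delete (v := v) (h ?_ ?_ ?_ ?_ ?_ ?_ ?_ ?_ ?_)).mono (by omega) <;>
        clear h <;> grind
  · have hab1 : ¬ G.Adj b a' := by
      rw [hbN]
      have := haa.ne
      grind
    have hba1 : ¬ G.Adj a b' := by
      rw [haN]
      have := hbb.ne
      grind
    have hwa' : ¬ G.Adj w a' := by
      rw [hwN]
      have := haa.ne
      grind
    have hwb' : ¬ G.Adj w b' := by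
      rw [hwN]
      have := hbb.ne
      grind
    -- Deleting `v` and `a` costs 1 + 3, the pendants `w` and `b` gain 4, and `a'` is left with
    -- degree 1 or 2 unless it has degree 4 and misses `v`.
    have key : ∀ a b a' b', G.Adj w a → G.Adj w b → G.Adj a b → a ≠ v → b ≠ v → a' ≠ v →
        (∀ y, G.Adj w y ↔ y = v ∨ y = a ∨ y = b) → (∀ y, G.Adj b y ↔ y = w ∨ y = a ∨ y = b') →
        b' ≠ v → G.Adj a a' → ¬ G.Adj b a' → ¬ G.Adj w a' → ¬ G.Adj a b' → G.Adj b b' →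
        ¬ G.Adj w b' → (G.deleteIncidenceSet v).deg a = 3 →
        (G.deg a' = 4 ∧ ¬ G.Adj v a') ∨ G.HasSlack 1 := by
      intro a b a' b' hwa hwb hab hav hbv hav' hwN hbN hbv' haa hba' hwa' hab' hbb hwb' hda
      by_contra hcon
      push Not at hcon
      refine hcon.2 ?_
      have haw : w ≠ a' := by rintro rfl; exact hba' hwb.symm
      have hab2 : b ≠ a' := by rintro rfl; exact hwa' hwb
      have hbw : b' ≠ w := by rintro rfl; exact hab' hwa.symm
      have hba2 : b' ≠ a := by rintro rfl; exact hwb' hwa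
      have h1 := deg_deleteIncidenceSet_of_adj (G := G.deleteIncidenceSet v) (u := a) (v := a')
        (by rw [deleteIncidenceSet_adj]; exact ⟨haa, hav, hav'⟩)
      have h2 : (((G.deleteIncidenceSet v).deleteIncidenceSet a).deleteIncidenceSet w).deg a'
          = _ := deg_deleteIncidenceSet_of_not_adj haw
            (by simp only [deleteIncidenceSet_adj]; tauto)
      have h3 : ((((G.deleteIncidenceSet v).deleteIncidenceSet a).deleteIncidenceSet
          w).deleteIncidenceSet b).deg a' = _ := deg_deleteIncidenceSet_of_not_adj hab2
            (by simp only [deleteIncidenceSet_adj]; tauto)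
      have h4 : (G.deleteIncidenceSet v).deg a' = 2 ∨ (G.deleteIncidenceSet v).deg a' = 3 := by
        have := hdeg' haa.symm
        by_cases hvp : G.Adj v a'
        · have := deg_deleteIncidenceSet_of_adj hvp
          omega
        · rw [deg_deleteIncidenceSet_of_not_adj hav'.symm hvp]
          have := hcon.1
          tauto
      refine (HasSlack.delete (v := v) (HasSlack.delete (v := a) (HasSlack.pendant (v := w)
        (a := b) (HasSlack.pendant (v := b) (a := b')
          (hasSlack_one_of_deg (v := a') ih ?_ ?_ ?_ ?_) ?_) ?_))).mono ?_
      · exact (size_deleteIncidenceSet_le _ _).trans ((size_deleteIncidenceSet_le _ _).trans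
          ((size_deleteIncidenceSet_le _ _).trans (hle v)))
      · omega
      · omega
      · omega
      · intro y
        simp only [deleteIncidenceSet_adj, hbN]
        have := hab.ne
        have := hwb.ne
        grind
      · intro y
        simp only [deleteIncidenceSet_adj, hwN]
        have := hwa.ne
        have := hab.ne
        have := hvw.ne
        grind
      · omega
    have hdb : (G.deleteIncidenceSet v).deg b = 3 := by
      rw [deg_deleteIncidenceSet_of_not_adj hvb hvb', hb3]
    rcases key a b a' b' hwa hwb hadj hva.symm hvb.symm hav hwN hbN hbv haa hab1 hwa' hba1 hbb
      hwb' hda with ha' | h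
    swap
    · exact h
    rcases key b a b' a' hwb hwa hadj.symm hvb.symm hva.symm hbv
      (fun y => by rw [hwN]; tauto) haN hav hbb hba1 hwb' hab1 haa hwa' hdb with hb' | h
    swap
    · exact h
    refine hasSlack_one_of_triangle_of_three (v := v) (p := a') (q := b') ih hn hwa hwb hadj ?_
        ?_ ?_ ?_ hv ha'.1 hb'.1 ha'.2 hb'.2
    · simp only [List.nodup_cons, List.mem_cons, List.not_mem_nil, not_or]
      have := hwa.ne
      have := hwb.ne
      have := haa.ne
      have := hbb.ne
      have := hvw.ne
      refine ⟨?_, ?_, ?_, ?_, ?_, ?_⟩ <;> grind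
    all_goals
      intro y hy
      simp only [List.mem_cons, List.not_mem_nil]
      grind

end Mixed

/-! ### Regular cases, the induction and the lower bound -/

section Existence

variable {V : Type*} [Finite V]

/-- Deleting `v` costs 3. If the other neighbors of `w` are nonadjacent, suppressing `w` gains 2,
and another neighbor `w'` of `v` still has degree 2, which gains 1. If no choice of `v` works, the
component is `K₄`. -/
theorem hasSlack_of_cubic {G : SimpleGraph V} {n : ℕ}
    (ih : ∀ H : SimpleGraph V, H.size < n → H.HasSlack 0) (hn : G.size ≤ n)
    (hdeg : ∀ x, G.deg x = 0 ∨ G.deg x = 3) {w v : V} (hwv : G.Adj w v) : G.HasSlack 0 := by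
  have hdeg' : ∀ {x y}, G.Adj x y → G.deg x = 3 := fun {x y} h => by
    have := deg_pos h
    have := hdeg x
    omega
  have key : ∀ v a b, v ≠ a → v ≠ b → a ≠ b → (∀ y, G.Adj w y ↔ y = v ∨ y = a ∨ y = b) →
      ¬ G.Adj a b → G.HasSlack 0 := by
    intro v a b hva hvb hab hwN hnab
    have hwv : G.Adj w v := by simp [hwN]
    have hv := hdeg' hwv.symm
    obtain ⟨w', x, hw1, hx1, hxw, hvN⟩ := deg_eq_three_of_adj hv hwv.symm
    have hvw' : G.Adj v w' := by simp [hvN]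
    have hw'3 := hdeg' hvw'.symm
    have hw' : ∀ y, (G.deleteIncidenceSet v).Adj w y ↔ y = a ∨ y = b := by
      intro y
      rw [deleteIncidenceSet_adj, hwN]
      have := hwv.ne
      grind
    have hnab' : ¬ (G.deleteIncidenceSet v).Adj a b := fun h => hnab (deleteIncidenceSet_le _ _ h)
    have h1 := size_suppress_add_one hab hnab' hw'
    have h2 := size_deleteIncidenceSet_le G v
    have h3 := deg_suppress hab hnab' hw' hw1.symm
    have h4 := deg_deleteIncidenceSet_of_adj hvw'
    refine (HasSlack.delete (v := v) (HasSlack.suppress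
      (hasSlack_one_of_deg (v := w') ih ?_ ?_ ?_ ?_) hab hnab' hw')).mono ?_ <;> omega
  obtain ⟨a, b, hva, hvb, hab, hwN⟩ := deg_eq_three_of_adj (hdeg' hwv) hwv
  by_cases h1 : G.Adj a b
  swap
  · exact key v a b hva hvb hab hwN h1
  by_cases h2 : G.Adj v a
  swap
  · exact key b v a hvb.symm hab.symm hva (fun y => by rw [hwN]; tauto) h2
  by_cases h3 : G.Adj v b
  swap
  · exact key a v b hva.symm hab hvb (fun y => by rw [hwN]; tauto) h3
  have hwa : G.Adj w a := by simp [hwN]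
  have hwb : G.Adj w b := by simp [hwN]
  obtain ⟨a', -, -, haN⟩ := deg_eq_three_of_adj_of_adj (hdeg' h1) hwa.symm h1 hwb.ne
  obtain ⟨b', -, -, hbN⟩ := deg_eq_three_of_adj_of_adj (hdeg' h1.symm) hwb.symm h1.symm hwa.ne
  have := (haN v).1 h2.symm
  have := (hbN v).1 h3.symm
  have h := hasSlack_of_isolated_triangle (G := G.deleteIncidenceSet v) (x := w) (a := a)
    (b := b) ih ((size_deleteIncidenceSet_le _ _).trans hn)
  simp only [deleteIncidenceSet_adj] at h
  have hv3 := hdeg' h3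
  have := hwv.ne
  refine (HasSlack.delete (v := v) (h ?_ ?_ ?_ ?_ ?_ ?_)).mono (by omega) <;> clear h <;> grind

theorem hasSlack_of_quartic {G : SimpleGraph V} {n : ℕ}
    (ih : ∀ H : SimpleGraph V, H.size < n → H.HasSlack 0) (hn : G.size ≤ n)
    (hmix : ∀ x y, G.Adj x y → G.deg x = 4 → G.deg y = 4) {v : V} (hv : G.deg v = 4) :
    G.HasSlack 0 := by
  have hle : ∀ u, (G.deleteIncidenceSet u).size ≤ n := fun u =>
    (size_deleteIncidenceSet_le _ _).trans hn
  have one : ∀ u, G.deg u = 4 → (G.deleteIncidenceSet u).HasSlack 1 → G.HasSlack 0 :=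
    fun u hu h => (HasSlack.delete h).mono (by omega)
  have hsub : ∀ u, G.deg u = 4 → (∀ x, (G.deleteIncidenceSet u).deg x = 0 ∨
      (G.deleteIncidenceSet u).deg x = 3 ∨ (G.deleteIncidenceSet u).deg x = 4) ∨
      G.HasSlack 0 := by
    intro u hu
    by_contra hcon
    push Not at hcon
    obtain ⟨⟨x, h0, h3, h4⟩, hG⟩ := hcon
    exact hG (one u hu (hasSlack_one_of_deg ih (hle u) h0 h3 h4))
  by_cases hex : ∃ w u, G.Adj v w ∧ G.Adj w u ∧ u ≠ v ∧ ¬ G.Adj v u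
  · obtain ⟨w, u, hvw, hwu, huv, hvu⟩ := hex
    have hw4 := hmix v w hvw hv
    have hu4 := hmix w u hwu hw4
    rcases hsub v hv with hd | h
    swap
    · exact h
    have hwv3 := deg_deleteIncidenceSet_of_adj hvw
    have huv4 := deg_deleteIncidenceSet_of_not_adj huv.symm hvu
    -- In the exceptional case `w` has a neighbor `a ≠ u` still of degree 4 in `G - v`, hence not
    -- adjacent to `v`.
    rcases hasSlack_one_of_adj_of_deg (w := w) ih (hle v) hd (huv4.trans hu4) (by omega)
      (by rw [deleteIncidenceSet_adj]; exact ⟨hwu.symm, huv, hvw.ne'⟩) with h | ⟨-, a, hwa, hau, ha⟩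
    · exact one v hv h
    rw [deleteIncidenceSet_adj] at hwa
    have ha4 := hmix w a hwa.1 hw4
    have hva : ¬ G.Adj v a := by
      intro h
      have := deg_deleteIncidenceSet_of_adj h
      omega
    rcases hsub a ha4 with hd' | h
    swap
    · exact h
    have hwa3 := deg_deleteIncidenceSet_of_adj hwa.1.symm
    have hva4 := deg_deleteIncidenceSet_of_not_adj hwa.2.2 (fun h => hva h.symm)
    -- With `a` deleted instead, the exception would force `u`, a neighbor of `w`, to be adjacent to
    -- `v`.
    rcases hasSlack_one_of_adj_of_deg (w := w) ih (hle a) hd' (hva4.trans hv) (by omega)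
      (by rw [deleteIncidenceSet_adj]; exact ⟨hvw, hwa.2.2.symm, hwa.1.ne⟩) with h | ⟨h, -⟩
    · exact one a ha4 h
    · have := h u
      simp only [deleteIncidenceSet_adj] at this
      have := hwa.1.ne
      tauto
  -- No vertex is at distance 2 from `v`, so the component is `K₅`; after deleting `v`, the vertex
  -- `w` of degree 3 cuts off a triangle.
  · push Not at hex
    obtain ⟨w, hvw⟩ := (Set.ncard_pos).1 (show 0 < (G.neighborSet v).ncard by
      change 0 < G.deg v; omega)
    change G.Adj v w at hvw
    have hw4 := hmix v w hvw hv
    obtain ⟨x, hx⟩ : ∃ x, G.Adj w x ∧ x ≠ v := by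
      have h := deg_deleteIncidenceSet_of_adj hvw
      obtain ⟨x, hx⟩ := (Set.ncard_pos).1
        (show 0 < ((G.deleteIncidenceSet v).neighborSet w).ncard by
          change 0 < (G.deleteIncidenceSet v).deg w; omega)
      rw [mem_neighborSet, deleteIncidenceSet_adj] at hx
      exact ⟨x, hx.1, hx.2.2⟩
    have hvx := hex w x hvw hx.1 hx.2
    obtain ⟨a, b, hwa, hxa, hwb, hxb, hab, hvN⟩ := deg_eq_four_of_adj_of_adj hv hvw hvx hx.1.ne
    have hcl : ∀ y z, G.Adj v y → G.Adj y z → z ≠ v → z = w ∨ z = x ∨ z = a ∨ z = b :=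
      fun y z h1 h2 h3 => (hvN z).1 (hex y z h1 h2 h3)
    have hfull : ∀ y, G.Adj v y → ∀ z, G.Adj v z → y ≠ z → G.Adj y z := by
      intro y hy z hz hyz
      by_contra hyz'
      have h4 := hmix v y hy hv
      have hs : G.neighborSet y ⊆ {v, w, x, a, b} \ {y, z} := by
        intro t ht
        have ht' : G.Adj y t := ht
        have h1 := hcl y t hy ht'
        have h2 := ht'.ne
        have h3 : t ≠ z := by rintro rfl; exact hyz' ht'
        simp only [Set.mem_sdiff, Set.mem_insert_iff, Set.mem_singleton_iff]
        tauto
      have h5 := Set.ncard_le_ncard hs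
      have h6 : ({y, z} : Set V) ⊆ {v, w, x, a, b} := by
        rintro t (rfl | rfl)
        · exact Or.inr ((hvN _).1 hy)
        · exact Or.inr ((hvN _).1 hz)
      rw [Set.ncard_sdiff h6, Set.ncard_pair hyz] at h5
      have h7 : ({v, w, x, a, b} : Set V).ncard ≤ 5 := by
        refine (Set.ncard_insert_le _ _).trans (Nat.succ_le_succ ?_)
        refine (Set.ncard_insert_le _ _).trans (Nat.succ_le_succ ?_)
        exact (Set.ncard_insert_le _ _).trans (Nat.succ_le_succ (Set.ncard_pair hab).le)
      change G.deg y ≤ _ at h5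
      omega
    have hva : G.Adj v a := by simp [hvN]
    have hvb : G.Adj v b := by simp [hvN]
    have h := hasSlack_of_triangle_of_cut (G := G.deleteIncidenceSet v) (x := x) (a := a)
      (b := b) (z := w) ih (hle v)
    simp only [deleteIncidenceSet_adj] at h
    have hw3 := deg_deleteIncidenceSet_of_adj hvw
    have := hfull x hvx a hva hxa
    have := hfull x hvx b hvb hxb
    have := hfull a hva b hvb hab
    have := hx.1.ne
    refine (HasSlack.delete (v := v) (h ?_ ?_ ?_ ?_ ?_ ?_ ?_ ?_ ?_)).mono (by omega) <;>
      clear h <;> grind [Adj.ne]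

theorem hasSlack_zero (G : SimpleGraph V) : G.HasSlack 0 := by
  obtain ⟨n, hn⟩ : ∃ n, G.size = n := ⟨_, rfl⟩
  induction n using Nat.strong_induction_on generalizing G with
  | _ n ih =>
    have ih : ∀ H : SimpleGraph V, H.size < n → H.HasSlack 0 := fun H hH => ih _ hH H rfl
    by_cases hdeg : ∀ x, G.deg x = 0 ∨ G.deg x = 3 ∨ G.deg x = 4
    swap
    · push Not at hdeg
      obtain ⟨x, h0, h3, h4⟩ := hdeg
      exact (hasSlack_one_of_deg ih hn.le h0 h3 h4).mono (by norm_num)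
    by_cases hmix : ∀ x y, G.Adj x y → G.deg x = 4 → G.deg y = 4
    swap
    · push Not at hmix
      obtain ⟨x, y, hxy, hx, hy⟩ := hmix
      have h1 := deg_pos hxy.symm
      have h2 := hdeg y
      have h3 := deg_deleteIncidenceSet_of_adj hxy
      exact (HasSlack.delete (v := x) (hasSlack_one_of_deg (v := y) ih
        ((size_deleteIncidenceSet_le _ _).trans hn.le) (by omega) (by omega) (by omega))).mono
        (by omega)
    by_cases hv : ∃ v, G.deg v = 4
    · obtain ⟨v, hv⟩ := hv
      exact hasSlack_of_quartic ih hn.le hmix hv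
    by_cases hadj : ∃ w v, G.Adj w v
    · obtain ⟨w, v, hwv⟩ := hadj
      refine hasSlack_of_cubic ih hn.le (fun x => ?_) hwv
      have := hdeg x
      have := not_exists.1 hv x
      tauto
    · exact ⟨∅, id, fun x y hxy => absurd ⟨x, y, hxy⟩ hadj, by simp⟩

theorem exists_induced_isPseudoforest {V : Type*} [Fintype V] (G : SimpleGraph V) :
    ∃ S : Finset V, (G.induce (S : Set V)).IsPseudoforest ∧
      (Fintype.card V : ℝ) - 2 * (G.edgeSet.ncard : ℝ) / 9 ≤ (S.card : ℝ) := by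
  classical
  obtain ⟨R, f, h1, h2⟩ := G.hasSlack_zero
  refine ⟨Rᶜ, isPseudoforest_induce (f := f) ?_, ?_⟩
  · intro x hx y hy hxy
    have := h1 x y hxy
    simp only [Finset.coe_compl, Set.mem_compl_iff, Finset.mem_coe] at hx hy
    tauto
  · rw [Finset.card_compl, Nat.cast_sub (Finset.card_le_univ R)]
    have h3 : (9 * (R.card : ℝ) + 0) ≤ 2 * G.size := by exact_mod_cast h2
    have h4 : (G.size : ℝ) = G.edgeSet.ncard := rfl
    linarith

end Existence

/-! ### Disjoint copies of `K₃,₃` -/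

section Tightness

set_option synthInstance.maxSize 1000 in
set_option maxRecDepth 10000 in
theorem exists_inl_or_inr_of_four_lt_card : ∀ T : Finset (Fin 3 ⊕ Fin 3), 4 < T.card →
    (∃ p q : Fin 3, p ≠ q ∧ Sum.inl p ∈ T ∧ Sum.inl q ∈ T ∧ ∀ j : Fin 3, Sum.inr j ∈ T) ∨
    (∃ p q : Fin 3, p ≠ q ∧ Sum.inr p ∈ T ∧ Sum.inr q ∈ T ∧ ∀ j : Fin 3, Sum.inl j ∈ T) := by
  decide

/-- Five vertices in one copy would include two from one side and all three from the other, a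
`K₂,₃`. -/
theorem card_le_four_of_isPseudoforest {k : ℕ} (S : Finset (Fin k × (Fin 3 ⊕ Fin 3)))
    (hS : ((disjointCopies k (completeBipartiteGraph (Fin 3) (Fin 3))).induce
      (S : Set _)).IsPseudoforest) : S.card ≤ 4 * k := by
  have hfib : ∀ i ∈ (Finset.univ : Finset (Fin k)), (S.filter (fun x => x.1 = i)).card ≤ 4 := by
    intro i _
    by_contra! hcard
    let T : Finset (Fin 3 ⊕ Fin 3) := Finset.univ.filter fun x => (i, x) ∈ S
    have hT : 4 < T.card := by
      refine hcard.trans_le (Finset.card_le_card_of_injOn Prod.snd ?_ ?_)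
      · rintro ⟨j, x⟩ hx
        simp only [Finset.coe_filter, Set.mem_ofPred_eq] at hx
        obtain ⟨hx, rfl⟩ := hx
        simpa [T] using hx
      · rintro ⟨j, x⟩ hx ⟨l, y⟩ hy hxy
        simp only [Finset.coe_filter, Set.mem_ofPred_eq] at hx hy
        simp_all
    have hmem : ∀ x ∈ T, (i, x) ∈ (S : Set (Fin k × (Fin 3 ⊕ Fin 3))) := fun x hx => by
      simpa [T] using hx
    rcases exists_inl_or_inr_of_four_lt_card T hT with ⟨p, q, hpq, hp, hq, hall⟩ | ⟨p, q, hpq, hp, hq, hall⟩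
    · refine hS.not_completeBipartite_two_three (a := ⟨_, hmem _ hp⟩) (b := ⟨_, hmem _ hq⟩)
        (x := ⟨_, hmem _ (hall 0)⟩) (y := ⟨_, hmem _ (hall 1)⟩) (z := ⟨_, hmem _ (hall 2)⟩)
        ?_ ?_ ?_ ?_ ?_ ?_ ?_ ?_ ?_ ?_ <;> simp [disjointCopies, hpq]
    · refine hS.not_completeBipartite_two_three (a := ⟨_, hmem _ hp⟩) (b := ⟨_, hmem _ hq⟩)
        (x := ⟨_, hmem _ (hall 0)⟩) (y := ⟨_, hmem _ (hall 1)⟩) (z := ⟨_, hmem _ (hall 2)⟩)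
        ?_ ?_ ?_ ?_ ?_ ?_ ?_ ?_ ?_ ?_ <;> simp [disjointCopies, hpq]
  have := Finset.card_le_mul_card_image_of_maps_to (f := Prod.fst) (s := S)
    (t := Finset.univ) (fun _ _ => Finset.mem_univ _) 4 hfib
  simpa using this

theorem ncard_edgeSet_disjointCopies (k : ℕ) :
    (disjointCopies k (completeBipartiteGraph (Fin 3) (Fin 3))).edgeSet.ncard = 9 * k := by
  classical
  set G := disjointCopies k (completeBipartiteGraph (Fin 3) (Fin 3)) with hG
  have hd : ∀ v, G.degree v = 3 := by
    rintro ⟨i, x⟩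
    have hadj : ∀ j y, G.Adj (i, x) (j, y) ↔
        i = j ∧ (completeBipartiteGraph (Fin 3) (Fin 3)).Adj x y := fun _ _ => Iff.rfl
    have : G.neighborFinset (i, x) = ((completeBipartiteGraph (Fin 3) (Fin 3)).neighborFinset
        x).map ⟨Prod.mk i, Prod.mk_right_injective i⟩ := by
      ext ⟨j, y⟩
      rw [mem_neighborFinset, hadj]
      simp
      tauto
    rw [degree, this, Finset.card_map]
    have hreg : ∀ x, (Finset.univ.filter
      (fun y => (completeBipartiteGraph (Fin 3) (Fin 3)).Adj x y)).card = 3 := by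
      simp only [completeBipartiteGraph_adj]
      decide
    refine (congrArg Finset.card ?_).trans (hreg x)
    ext y
    simp
  have h := G.sum_degrees_eq_twice_card_edges
  simp only [hd, Finset.sum_const, Finset.card_univ, Fintype.card_prod, Fintype.card_sum,
    Fintype.card_fin, smul_eq_mul] at h
  rw [← coe_edgeFinset, Set.ncard_coe_finset]
  omega

end Tightness

end SimpleGraph

theorem theorem1 :
    (∀ (V : Type*) [Fintype V] (G : SimpleGraph V),
      ∃ S : Finset V, (G.induce (S : Set V)).IsPseudoforest ∧
        (Fintype.card V : ℝ) - 2 * (G.edgeSet.ncard : ℝ) / 9 ≤ (S.card : ℝ)) ∧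
    (∀ (k n m : ℕ) (G : SimpleGraph (Fin k × (Fin 3 ⊕ Fin 3))),
      G = SimpleGraph.disjointCopies k (completeBipartiteGraph (Fin 3) (Fin 3)) →
      n = Fintype.card (Fin k × (Fin 3 ⊕ Fin 3)) →
      m = G.edgeSet.ncard →
        n = 6 * k ∧ m = 9 * k ∧
        (∃ S : Finset (Fin k × (Fin 3 ⊕ Fin 3)), (G.induce (S : Set _)).IsPseudoforest ∧
          (S.card : ℝ) = (n : ℝ) - 2 * (m : ℝ) / 9) ∧
        (∀ S : Finset (Fin k × (Fin 3 ⊕ Fin 3)), (G.induce (S : Set _)).IsPseudoforest →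
          (S.card : ℝ) ≤ (n : ℝ) - 2 * (m : ℝ) / 9)) := by
  refine ⟨fun V _ G => G.exists_induced_isPseudoforest, ?_⟩
  rintro k n m G rfl hn hm
  have hn' : n = 6 * k := by
    rw [hn]
    simp
    ring
  have hm' : m = 9 * k := hm.trans (SimpleGraph.ncard_edgeSet_disjointCopies k)
  have hub : ∀ S : Finset (Fin k × (Fin 3 ⊕ Fin 3)),
      ((SimpleGraph.disjointCopies k (completeBipartiteGraph (Fin 3) (Fin 3))).induce
        (S : Set _)).IsPseudoforest → (S.card : ℝ) ≤ (n : ℝ) - 2 * (m : ℝ) / 9 := by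
    intro S hS
    have h : (S.card : ℝ) ≤ 4 * k := by
      exact_mod_cast SimpleGraph.card_le_four_of_isPseudoforest S hS
    rw [hn', hm']
    push_cast
    linarith
  refine ⟨hn', hm', ?_, hub⟩
  -- The general lower bound supplies an extremal set; no explicit one is needed.
  obtain ⟨S, hS, hcard⟩ := SimpleGraph.exists_induced_isPseudoforest
    (SimpleGraph.disjointCopies k (completeBipartiteGraph (Fin 3) (Fin 3)))
  rw [← hn, ← hm] at hcard
  exact ⟨S, hS, (hub S hS).antisymm hcard⟩
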